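/- Let $x\in\mathbb{R}$, $\alpha,\beta,\delta\in\mathbb{C}$ and $\gamma>0$ be such that $\beta x^{\alpha}\neq 0$ (principal branch of the power). Then the series below converges absolutely, the H-function on the right exists, and $$\sum_{n=0}^{\infty}\frac{x^{\alpha n}\beta^{n}}{\Gamma(\gamma n+\delta+1)}=H^{1,1}_{1,2}\left[-\beta x^{\alpha}\;\middle|\;\begin{matrix}(0,1)\\(0,1),(-\delta,\gamma)\end{matrix}\right].$$ Here $1/\Gamma=0$ at the poles of $\Gamma$, and for $z\ne0$ $$H^{m,n}_{p,q}\left[z\;\middle|\;\begin{matrix}(a_1,A_1),\dots,(a_p,A_p)\\(b_1,B_1),\dots,(b_q,B_q)\end{matrix}\right]=\frac1{2\pi i}\int_L\frac{\prod_{j=1}^m\Gamma(b_j+B_js)\prod_{j=1}^n\Gamma(1-a_j-A_js)}{\prod_{j=m+1}^q\Gamma(1-b_j-B_js)\prod_{j=n+1}^p\Gamma(a_j+A_js)}\,z^{-s}\,ds$$ with the principal branch of $z^{-s}$, where $L$ is a contour that separates the poles of the $\Gamma(b_j+B_js)$, $j\le m$, from those of the $\Gamma(1-a_j-A_js)$,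 $j\le n$, and along which the integral converges absolutely: either a vertical line from $c-i\infty$ to $c+i\infty$ with the former poles on its left and the latter on its right; or a rectangular loop that starts at $-\infty+i\varphi_1$ and ends at $-\infty+i\varphi_2$, $\varphi_1<\varphi_2$, and encircles all of the former poles once counterclockwise and none of the latter; or a rectangular loop that starts at $+\infty+i\varphi_1$ and ends at $+\infty+i\varphi_2$, $\varphi_1<\varphi_2$, and encircles all of the latter poles once clockwise and none of the former. That the H-function exists and equals $v$ means that there is at least one such contour and that the right-hand side equals $v$ for every such contour. -/

import Mathlib

open MeasureTheory

/-!
The Fox H-function `H^{m,n}_{p,q}[z | (a₁,A₁),…,(a_p,A_p); (b₁,B₁),…,(b_q,B_q)]`, as a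
Mellin-Barnes integral.  The parameters are families of pairs `a j = (a_j, A_j)`, `b j = (b_j, B_j)`
with complex first and positive real second entries; the indices in `Fin p`, `Fin q` start at `0`,
so that `j ≤ n`, `j ≤ m` in the usual numbering become `(j : ℕ) < n`, `(j : ℕ) < m`.
-/

namespace FoxH

/-- The quotient of Gamma products
`∏_{j≤m} Γ(b_j + B_j s) ∏_{j≤n} Γ(1 - a_j - A_j s) /
  (∏_{j>m} Γ(1 - b_j - B_j s) ∏_{j>n} Γ(a_j + A_j s))`.
At a pole of a Gamma function of the denominator `1 / Γ` is `0`, as it should be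
(Mathlib gives `Γ` the value `0` there, and `0⁻¹ = 0`). -/
noncomputable def kernel (m n : ℕ) {p q : ℕ} (a : Fin p → ℂ × ℝ) (b : Fin q → ℂ × ℝ) (s : ℂ) : ℂ :=
  (∏ j : Fin q, if (j : ℕ) < m then Complex.Gamma ((b j).1 + ((b j).2 : ℂ) * s)
      else (Complex.Gamma (1 - (b j).1 - ((b j).2 : ℂ) * s))⁻¹) *
  (∏ j : Fin p, if (j : ℕ) < n then Complex.Gamma (1 - (a j).1 - ((a j).2 : ℂ) * s)
      else (Complex.Gamma ((a j).1 + ((a j).2 : ℂ) * s))⁻¹)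

/-- The integrand, `kernel · z^{-s}`, with the principal branch of `z^{-s}`. -/
noncomputable def integrand (m n : ℕ) {p q : ℕ} (a : Fin p → ℂ × ℝ) (b : Fin q → ℂ × ℝ)
    (z s : ℂ) : ℂ :=
  kernel m n a b s * z ^ (-s)

/-- The poles of `Γ(b_j + B_j s)`, `j ≤ m`: the points with `b_j + B_j s = -k`, `k ∈ ℕ`. -/
def leftPoles (m : ℕ) {q : ℕ} (b : Fin q → ℂ × ℝ) : Set ℂ :=
  {s | ∃ j : Fin q, (j : ℕ) < m ∧ ∃ k : ℕ, (b j).1 + ((b j).2 : ℂ) * s = -(k : ℂ)}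

/-- The poles of `Γ(1 - a_j - A_j s)`, `j ≤ n`: the points with `1 - a_j - A_j s = -k`, `k ∈ ℕ`. -/
def rightPoles (n : ℕ) {p : ℕ} (a : Fin p → ℂ × ℝ) : Set ℂ :=
  {s | ∃ j : Fin p, (j : ℕ) < n ∧ ∃ k : ℕ, 1 - (a j).1 - ((a j).2 : ℂ) * s = -(k : ℂ)}

/-- The three kinds of Mellin-Barnes contours.
* `vertical c`: the line from `c - i∞` to `c + i∞`.
* `leftLoop c φ₁ φ₂`: the loop from `-∞ + iφ₁` to `c + iφ₁` to `c + iφ₂` to `-∞ + iφ₂`.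
* `rightLoop c φ₁ φ₂`: the loop from `+∞ + iφ₁` to `c + iφ₁` to `c + iφ₂` to `+∞ + iφ₂`. -/
inductive Contour where
  | vertical (c : ℝ)
  | leftLoop (c φ₁ φ₂ : ℝ)
  | rightLoop (c φ₁ φ₂ : ℝ)

/-- The contour separates the set `P` (poles to the left of it) from the set `Q` (poles to the
right of it): the line has `P` strictly on its left and `Q` strictly on its right; the left loop
encircles all of `P` (counterclockwise) and no point of `Q`; the right loop encircles all of `Q`
(clockwise) and no point of `P`.  No pole lies on the contour. -/
def Contour.Separates : Contour → Set ℂ → Set ℂ → Prop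
  | .vertical c, P, Q => (∀ s ∈ P, s.re < c) ∧ (∀ s ∈ Q, c < s.re)
  | .leftLoop c φ₁ φ₂, P, Q => φ₁ < φ₂ ∧
      (∀ s ∈ P, s.re < c ∧ φ₁ < s.im ∧ s.im < φ₂) ∧
      (∀ s ∈ Q, ¬ (s.re ≤ c ∧ φ₁ ≤ s.im ∧ s.im ≤ φ₂))
  | .rightLoop c φ₁ φ₂, P, Q => φ₁ < φ₂ ∧
      (∀ s ∈ P, ¬ (c ≤ s.re ∧ φ₁ ≤ s.im ∧ s.im ≤ φ₂)) ∧
      (∀ s ∈ Q, c < s.re ∧ φ₁ < s.im ∧ s.im < φ₂)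

/-- `∫_L f(s) ds` converges absolutely on the unbounded parts of the contour (on the bounded part
of a loop that avoids the poles, the integrand is continuous). -/
def Contour.Converges : Contour → (ℂ → ℂ) → Prop
  | .vertical c, f => Integrable (fun t : ℝ => f (c + t * Complex.I))
  | .leftLoop c φ₁ φ₂, f =>
      IntegrableOn (fun x : ℝ => f (x + φ₁ * Complex.I)) (Set.Iic c) ∧
      IntegrableOn (fun x : ℝ => f (x + φ₂ * Complex.I)) (Set.Iic c)
  | .rightLoop c φ₁ φ₂, f =>
      IntegrableOn (fun x : ℝ => f (x + φ₁ * Complex.I)) (Set.Ici c) ∧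
      IntegrableOn (fun x : ℝ => f (x + φ₂ * Complex.I)) (Set.Ici c)

/-- The contour integral `∫_L f(s) ds`. -/
noncomputable def Contour.integral : Contour → (ℂ → ℂ) → ℂ
  | .vertical c, f => Complex.I * ∫ t : ℝ, f (c + t * Complex.I)
  | .leftLoop c φ₁ φ₂, f =>
      (∫ x in Set.Iic c, f (x + φ₁ * Complex.I)) +
      Complex.I * (∫ y in φ₁..φ₂, f (c + y * Complex.I)) -
      ∫ x in Set.Iic c, f (x + φ₂ * Complex.I)
  | .rightLoop c φ₁ φ₂, f =>
      -(∫ x in Set.Ici c, f (x + φ₁ * Complex.I)) +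
      Complex.I * (∫ y in φ₁..φ₂, f (c + y * Complex.I)) +
      ∫ x in Set.Ici c, f (x + φ₂ * Complex.I)

/-- `H^{m,n}_{p,q}[z | a; b]` exists and equals `v`: `z ≠ 0`, there is a contour that separates the
left from the right poles and along which the Mellin-Barnes integral converges, and for every such
contour `(1 / 2πi) ∫_L integrand = v`.  In particular `v` is unique. -/
def HasValue (m n : ℕ) {p q : ℕ} (a : Fin p → ℂ × ℝ) (b : Fin q → ℂ × ℝ) (z v : ℂ) : Prop :=
  z ≠ 0 ∧
  (∃ L : Contour, L.Separates (leftPoles m b) (rightPoles n a) ∧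
    L.Converges (integrand m n a b z)) ∧
  ∀ L : Contour, L.Separates (leftPoles m b) (rightPoles n a) →
    L.Converges (integrand m n a b z) →
    1 / (2 * Real.pi * Complex.I) * L.integral (integrand m n a b z) = v

end FoxH

/-! By the reflection formula the integrand is `π / sin (π s)` times the entire function `z ^ (-s) /
Γ(1 + δ - γ s)`. Its residues at `0, -1, -2, …` are exactly the terms of the series, so each
admissible contour must give `2πi` times the sum. Left loops: as `Re s → -∞`, `1/Γ` decays faster
than every exponential, so rectangles reaching ever further left exhaust the residues
(`integral_leftLoop_mlIntegrand`). This also gives existence and summability. Vertical lines: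
convergence is assumed, not proved. The segment from `c - iT` to `c + iT` misses a left loop by two
horizontal rays, whose integrals are at most a constant times the integrand at the segment's
endpoints (`norm_mlIntegrand_le_mul`). That bound is integrable in `T`, so the limiting discrepancy
is zero. Right loops: `1/Γ` makes the integrand grow to the right, so absolute convergence fails on
at least one of the two rays (`not_integrableOn_mlIntegrand_Ici`) and these loops need no
evaluation. -/

namespace FoxH

open Complex Set

/-! ### Decay of `1/Γ` to the right -/

/-- `Γ(r + u)` grows faster than every exponential. -/
theorem exists_exp_mul_le_Gamma_add {r : ℝ} (hr : 0 < r) (L : ℝ) :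
    ∃ K : ℝ, 0 < K ∧ ∀ u : ℝ, 0 ≤ u → K * Real.exp (L * u) ≤ Real.Gamma (r + u) := by
  have hA : 0 < Real.exp L := Real.exp_pos L
  have hsub : Ioi (Real.exp L) ⊆ Ioi (0 : ℝ) := Ioi_subset_Ioi hA.le
  have hint (v : ℝ) (hv : 0 < v) := (Real.GammaIntegral_convergent hv).mono_set hsub
  -- `K` is the tail of Euler's integral over `t > e^L`, where `t ^ u ≥ e^(L u)`.
  refine ⟨∫ t in Ioi (Real.exp L), Real.exp (-t) * t ^ (r - 1), ?_, fun u hu => ?_⟩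
  · rw [setIntegral_pos_iff_support_of_nonneg_ae _ (hint r hr)]
    · have : Ioi (Real.exp L) ⊆
          (Function.support fun t : ℝ => Real.exp (-t) * t ^ (r - 1)) ∩ Ioi (Real.exp L) := by
        intro t ht
        have ht0 : 0 < t := hsub ht
        exact ⟨(by positivity : Real.exp (-t) * t ^ (r - 1) ≠ 0), ht⟩
      exact lt_of_lt_of_le (by simp) (measure_mono this)
    · filter_upwards [ae_restrict_mem measurableSet_Ioi] with t ht
      have ht0 : 0 < t := hsub ht
      exact (by positivity : 0 ≤ Real.exp (-t) * t ^ (r - 1))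
  · rw [Real.Gamma_eq_integral (by positivity), ← integral_mul_const]
    calc ∫ t in Ioi (Real.exp L), Real.exp (-t) * t ^ (r - 1) * Real.exp (L * u)
        ≤ ∫ t in Ioi (Real.exp L), Real.exp (-t) * t ^ (r + u - 1) := by
          refine setIntegral_mono_on ((hint r hr).mul_const _) (hint _ (by positivity))
            measurableSet_Ioi fun t ht => ?_
          have ht0 : 0 < t := hsub ht
          have h1 : Real.exp (L * u) ≤ t ^ u := by
            rw [Real.exp_mul]
            exact Real.rpow_le_rpow hA.le (le_of_lt ht) hu
          have h2 : t ^ (r + u - 1) = t ^ (r - 1) * t ^ u := by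
            rw [← Real.rpow_add ht0]; ring_nf
          rw [h2, ← mul_assoc]
          gcongr
      _ ≤ ∫ t in Ioi (0 : ℝ), Real.exp (-t) * t ^ (r + u - 1) := by
          refine setIntegral_mono_set (Real.GammaIntegral_convergent (by positivity)) ?_
            hsub.eventuallyLE
          filter_upwards [ae_restrict_mem measurableSet_Ioi] with t ht
          have ht0 : 0 < t := ht
          exact (by positivity : 0 ≤ Real.exp (-t) * t ^ (r + u - 1))

/-- The modulus of the integrand depends only on the real parts. This makes the Gamma estimates
uniform in the imaginary part. -/
theorem norm_betaIntegral_le (w v : ℂ) :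
    ‖betaIntegral w v‖ ≤ ‖betaIntegral w.re v.re‖ := by
  have key (x : ℝ) (hx : x ∈ Ioo (0 : ℝ) 1) (a b : ℂ) :
      ‖(x : ℂ) ^ (a - 1) * (1 - (x : ℂ)) ^ (b - 1)‖ = x ^ (a.re - 1) * (1 - x) ^ (b.re - 1) := by
    have h1 : (1 - (x : ℂ)) = ((1 - x : ℝ) : ℂ) := by push_cast; ring
    rw [norm_mul, h1, norm_cpow_eq_rpow_re_of_pos hx.1,
      norm_cpow_eq_rpow_re_of_pos (sub_pos.2 hx.2)]
    simp
  have h2 : betaIntegral w.re v.re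
      = ((∫ x in (0 : ℝ)..1, ‖(x : ℂ) ^ (w - 1) * (1 - (x : ℂ)) ^ (v - 1)‖ : ℝ) : ℂ) := by
    rw [betaIntegral, ← intervalIntegral.integral_ofReal]
    refine intervalIntegral.integral_congr_ae' ?_ ?_
    · have : ∀ᵐ x : ℝ, x ≠ 1 := by simp [ae_iff]
      filter_upwards [this] with x hx1 hx
      have hx' : x ∈ Ioo (0 : ℝ) 1 := ⟨hx.1, lt_of_le_of_ne hx.2 hx1⟩
      rw [key x hx']
      rw [ofReal_mul, ofReal_cpow hx'.1.le, ofReal_cpow (sub_pos.2 hx'.2).le]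
      push_cast
      rfl
    · exact Filter.Eventually.of_forall fun x hx => by
        have := hx.1.trans_le hx.2; norm_num at this
  rw [h2, norm_real]
  exact (intervalIntegral.norm_integral_le_integral_norm zero_le_one).trans (le_abs_self _)

/-- From `Γ(w) Γ(u) = Γ(w + u) B(w, u)` and `|B(w, u)| ≤ B(r, u)` follows `|Γ(w) / Γ(w + u)| ≤ Γ(r)
/ Γ(r + u)`. The factor `1/Γ(w)` is kept because the vertical lines need a bound relative to the
starting point. -/
theorem norm_inv_Gamma_add_le_of_re_pos {r : ℝ} (hr : 0 < r) (L : ℝ) :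
    ∃ C : ℝ, 0 ≤ C ∧ ∀ w : ℂ, w.re = r → ∀ u : ℝ, 0 ≤ u →
      ‖(Gamma (w + u))⁻¹‖ ≤ C * Real.exp (-(L * u)) * ‖(Gamma w)⁻¹‖ := by
  obtain ⟨K, hK, hKu⟩ := exists_exp_mul_le_Gamma_add hr L
  have hG := Real.Gamma_pos_of_pos hr
  have hb : K ≤ Real.Gamma r := by simpa using hKu 0 le_rfl
  refine ⟨Real.Gamma r / K, by positivity, fun w hw u hu => ?_⟩
  have hw0 : 0 < w.re := hw ▸ hr
  have hGw : Gamma w ≠ 0 := Gamma_ne_zero_of_re_pos hw0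
  have hGwu : Gamma (w + u) ≠ 0 := Gamma_ne_zero_of_re_pos (by simp; positivity)
  rcases hu.eq_or_lt with rfl | hu
  · simp only [ofReal_zero, add_zero, mul_zero, neg_zero, Real.exp_zero, mul_one]
    exact le_mul_of_one_le_left (norm_nonneg _) ((one_le_div hK).2 hb)
  · have hu' : 0 < (u : ℂ).re := by simpa using hu
    have e1 := Gamma_mul_Gamma_eq_betaIntegral hw0 hu'
    have e2 := Gamma_mul_Gamma_eq_betaIntegral (s := (r : ℂ)) (t := (u : ℂ)) (by simpa) hu'
    have hGu : 0 < Real.Gamma u := Real.Gamma_pos_of_pos hu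
    have hle : ‖betaIntegral w u‖ ≤ ‖betaIntegral r u‖ := by
      simpa [hw] using norm_betaIntegral_le w u
    have n1 := congrArg norm e1
    have n2 := congrArg norm e2
    rw [← ofReal_add] at n2
    simp only [norm_mul, Gamma_ofReal, norm_real, Real.norm_of_nonneg hGu.le,
      Real.norm_of_nonneg hG.le] at n1 n2
    have hGru : 0 < Real.Gamma (r + u) := Real.Gamma_pos_of_pos (by positivity)
    rw [Real.norm_of_nonneg hGru.le] at n2
    have hlow := hKu u hu.le
    have hn1 : 0 < ‖Gamma w‖ := norm_pos_iff.2 hGw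
    have hn2 : 0 < ‖Gamma (w + u)‖ := norm_pos_iff.2 hGwu
    have h3 : ‖Gamma w‖ * Real.Gamma (r + u) ≤ ‖Gamma (w + u)‖ * Real.Gamma r := by
      refine le_of_mul_le_mul_right ?_ hGu
      calc ‖Gamma w‖ * Real.Gamma (r + u) * Real.Gamma u
          = ‖Gamma (w + u)‖ * Real.Gamma (r + u) * ‖betaIntegral w u‖ := by
            rw [mul_right_comm, n1]; ring
        _ ≤ ‖Gamma (w + u)‖ * Real.Gamma (r + u) * ‖betaIntegral r u‖ := by gcongr
        _ = _ := by rw [mul_assoc, ← n2]; ring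
    rw [norm_inv, norm_inv, Real.exp_neg]
    have h4 : ‖Gamma w‖ * (K * Real.exp (L * u)) ≤ ‖Gamma (w + u)‖ * Real.Gamma r :=
      (by gcongr : _ ≤ ‖Gamma w‖ * Real.Gamma (r + u)).trans h3
    have h5 : Real.Gamma r / K * (Real.exp (L * u))⁻¹ * ‖Gamma w‖⁻¹
        = Real.Gamma r / (‖Gamma w‖ * (K * Real.exp (L * u))) := by
      field_simp
    rw [h5, le_div_iff₀ (by positivity), inv_mul_le_iff₀ hn2]
    exact h4

theorem exists_nat_add_pos (r : ℝ) : ∃ m : ℕ, 0 < r + m := by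
  obtain ⟨m, hm⟩ := exists_nat_gt (-r)
  exact ⟨m, by linarith⟩

/-- The recursion `1/Γ(w) = w/Γ(w + 1)` reduces to positive real part. Each step costs `|w + u| /
|w| ≤ 1 + u ≤ e^u`, using `|w| ≥ 1`; the rate `L + 1` in the induction hypothesis absorbs it. -/
theorem norm_inv_Gamma_add_le_of_one_le_im (r L : ℝ) :
    ∃ C : ℝ, 0 ≤ C ∧ ∀ w : ℂ, w.re = r → 1 ≤ |w.im| → ∀ u : ℝ, 0 ≤ u →
      ‖(Gamma (w + u))⁻¹‖ ≤ C * Real.exp (-(L * u)) * ‖(Gamma w)⁻¹‖ := by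
  obtain ⟨m, hm⟩ := exists_nat_add_pos r
  induction m generalizing r L with
  | zero =>
    obtain ⟨C, hC, h⟩ := norm_inv_Gamma_add_le_of_re_pos (r := r) (by simpa using hm) L
    exact ⟨C, hC, fun w hw _ => h w hw⟩
  | succ m ih =>
    obtain ⟨C, hC, h⟩ := ih (r + 1) (L + 1) (by push_cast at hm; linarith)
    refine ⟨C, hC, fun w hw hi u hu => ?_⟩
    have h1 := h (w + 1) (by simp [hw]) (by simpa using hi) u hu
    have hw1 : 1 ≤ ‖w‖ := hi.trans (abs_im_le_norm w)
    have e1 := one_div_Gamma_eq_self_mul_one_div_Gamma_add_one w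
    have e2 := one_div_Gamma_eq_self_mul_one_div_Gamma_add_one (w + u)
    rw [show w + u + 1 = w + 1 + u by ring] at e2
    have h2 : ‖w + u‖ ≤ ‖w‖ * Real.exp u := by
      calc ‖w + u‖ ≤ ‖w‖ + u := by
            simpa [abs_of_nonneg hu] using norm_add_le w (u : ℂ)
        _ ≤ ‖w‖ * (u + 1) := by nlinarith
        _ ≤ _ := by gcongr; exact Real.add_one_le_exp u
    rw [e1, e2, norm_mul, norm_mul]
    calc ‖w + u‖ * ‖(Gamma (w + 1 + u))⁻¹‖
        ≤ (‖w‖ * Real.exp u) * (C * Real.exp (-((L + 1) * u)) * ‖(Gamma (w + 1))⁻¹‖) := by gcongr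
      _ = C * (Real.exp u * Real.exp (-((L + 1) * u))) * (‖w‖ * ‖(Gamma (w + 1))⁻¹‖) := by ring
      _ = _ := by rw [← Real.exp_add]; ring_nf

/-- A relative bound fails where `1/Γ(w)` vanishes, so on a bounded range of heights compactness
gives an absolute bound instead. -/
theorem norm_inv_Gamma_add_le_of_im_le (r L B : ℝ) :
    ∃ C : ℝ, 0 ≤ C ∧ ∀ w : ℂ, w.re = r → |w.im| ≤ B → ∀ u : ℝ, 0 ≤ u →
      ‖(Gamma (w + u))⁻¹‖ ≤ C * Real.exp (-(L * u)) := by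
  obtain ⟨m, hm⟩ := exists_nat_add_pos r
  induction m generalizing r L with
  | zero =>
    obtain ⟨C, hC, h⟩ := norm_inv_Gamma_add_le_of_re_pos (r := r) (by simpa using hm) L
    obtain ⟨D, hD⟩ := (isCompact_Icc (a := -B) (b := B)).exists_bound_of_continuousOn
      (f := fun y : ℝ => (Gamma (r + y * I))⁻¹)
      (differentiable_one_div_Gamma.continuous.comp (by fun_prop)).continuousOn
    refine ⟨C * max D 0, by positivity, fun w hw hi u hu => (h w hw u hu).trans ?_⟩
    have hw' : w = r + w.im * I := by rw [← hw, re_add_im]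
    have : ‖(Gamma w)⁻¹‖ ≤ max D 0 := by
      rw [hw']
      exact (hD w.im (abs_le.1 hi)).trans (le_max_left _ _)
    calc _ ≤ C * Real.exp (-(L * u)) * max D 0 := by gcongr
      _ = _ := by ring
  | succ m ih =>
    obtain ⟨C, hC, h⟩ := ih (r + 1) (L + 1) (by push_cast at hm; linarith)
    refine ⟨(|r| + |B| + 1) * C, by positivity, fun w hw hi u hu => ?_⟩
    have h1 := h (w + 1) (by simp [hw]) (by simpa using hi) u hu
    have e2 := one_div_Gamma_eq_self_mul_one_div_Gamma_add_one (w + u)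
    rw [show w + u + 1 = w + 1 + u by ring] at e2
    have hw1 : ‖w‖ ≤ |r| + |B| :=
      (norm_le_abs_re_add_abs_im w).trans
        (add_le_add (by rw [hw]) (hi.trans (le_abs_self B)))
    have h2 : ‖w + u‖ ≤ (|r| + |B| + 1) * Real.exp u := by
      calc ‖w + u‖ ≤ ‖w‖ + u := by
            simpa [abs_of_nonneg hu] using norm_add_le w (u : ℂ)
        _ ≤ (|r| + |B| + 1) * (u + 1) := by
            nlinarith [mul_nonneg (add_nonneg (abs_nonneg r) (abs_nonneg B)) hu]
        _ ≤ _ := by gcongr; exact Real.add_one_le_exp u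
    rw [e2, norm_mul]
    calc ‖w + u‖ * ‖(Gamma (w + 1 + u))⁻¹‖
        ≤ ((|r| + |B| + 1) * Real.exp u) * (C * Real.exp (-((L + 1) * u))) := by gcongr
      _ = (|r| + |B| + 1) * C * (Real.exp u * Real.exp (-((L + 1) * u))) := by ring
      _ = _ := by rw [← Real.exp_add]; ring_nf

/-! ### Bounds and zeros of the sine -/

theorem abs_sinh_im_le_norm_sin (s : ℂ) : |Real.sinh s.im| ≤ ‖sin s‖ := by
  have h : ‖2 * sin s‖ = ‖exp (-s * I) - exp (s * I)‖ := by
    rw [Complex.two_sin, norm_mul, norm_I, mul_one]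
  have e1 : ‖exp (-s * I)‖ = Real.exp s.im := by simp [norm_exp]
  have e2 : ‖exp (s * I)‖ = Real.exp (-s.im) := by simp [norm_exp]
  have := abs_norm_sub_norm_le (exp (-s * I)) (exp (s * I))
  rw [← h, e1, e2, norm_mul, norm_ofNat] at this
  rw [Real.sinh_eq, abs_div, abs_two]
  linarith

theorem norm_sin_le_cosh_im (s : ℂ) : ‖sin s‖ ≤ Real.cosh s.im := by
  have h : ‖2 * sin s‖ = ‖exp (-s * I) - exp (s * I)‖ := by
    rw [Complex.two_sin, norm_mul, norm_I, mul_one]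
  have e1 : ‖exp (-s * I)‖ = Real.exp s.im := by simp [norm_exp]
  have e2 : ‖exp (s * I)‖ = Real.exp (-s.im) := by simp [norm_exp]
  have := norm_sub_le (exp (-s * I)) (exp (s * I))
  rw [← h, e1, e2, norm_mul, norm_ofNat] at this
  rw [Real.cosh_eq]
  linarith

theorem cosh_le_two_mul_abs_sinh {y : ℝ} (hy : 1 ≤ |y|) : Real.cosh y ≤ 2 * |Real.sinh y| := by
  rw [Real.abs_sinh, ← Real.cosh_abs, Real.cosh_eq, Real.sinh_eq]
  have h1 : (2 : ℝ) ≤ Real.exp |y| := by linarith [Real.add_one_le_exp |y|]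
  have h2 : Real.exp (-|y|) * Real.exp |y| = 1 := by rw [← Real.exp_add]; simp
  nlinarith [Real.exp_pos (-|y|)]

theorem sin_pi_mul_ne_zero {s : ℂ} (hs : ∀ k : ℤ, s ≠ k) : sin (Real.pi * s) ≠ 0 := by
  rw [Ne, sin_eq_zero_iff]
  rintro ⟨k, hk⟩
  have hpi : (Real.pi : ℂ) ≠ 0 := ofReal_ne_zero.2 Real.pi_ne_zero
  exact hs k (mul_left_cancel₀ hpi (by rw [hk]; ring))

theorem ne_intCast_of_im_ne_zero {s : ℂ} (hs : s.im ≠ 0) (k : ℤ) : s ≠ k := by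
  rintro rfl
  simp at hs

theorem ne_intCast_of_re_mem_Ioo {s : ℂ} (m : ℤ) (hs : s.re ∈ Ioo (m : ℝ) (m + 1)) (k : ℤ) :
    s ≠ k := by
  rintro rfl
  obtain ⟨h1, h2⟩ := hs
  rw [intCast_re] at h1 h2
  have h1' : m < k := by exact_mod_cast h1
  have h2' : k < m + 1 := by exact_mod_cast h2
  omega

/-! ### The integrand and its decay to the left -/

/-- The entire factor of the Mittag-Leffler integrand. -/
noncomputable def entireFactor (δ : ℂ) (γ : ℝ) (z s : ℂ) : ℂ :=
  (Gamma (1 + δ - γ * s))⁻¹ * z ^ (-s)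

/-- The Mittag-Leffler integrand. -/
noncomputable def mlIntegrand (δ : ℂ) (γ : ℝ) (z s : ℂ) : ℂ :=
  Real.pi / sin (Real.pi * s) * entireFactor δ γ z s

theorem integrand_eq_mlIntegrand (δ : ℂ) (γ : ℝ) (z : ℂ) :
    integrand 1 1 ![((0 : ℂ), (1 : ℝ))] ![((0 : ℂ), (1 : ℝ)), (-δ, γ)] z = mlIntegrand δ γ z := by
  ext s
  rw [mlIntegrand, entireFactor, ← Gamma_mul_Gamma_one_sub]
  simp [integrand, kernel, Fin.prod_univ_two]
  ring

section

variable {δ z : ℂ} {γ : ℝ}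

theorem differentiable_entireFactor (hz : z ≠ 0) : Differentiable ℂ (entireFactor δ γ z) := by
  refine (differentiable_one_div_Gamma.comp (by fun_prop)).mul fun s => ?_
  exact (differentiableAt_id.neg).const_cpow (Or.inl hz)

theorem continuousAt_mlIntegrand (hz : z ≠ 0) {s : ℂ} (hs : ∀ k : ℤ, s ≠ k) :
    ContinuousAt (mlIntegrand δ γ z) s := by
  refine ContinuousAt.mul ?_ (differentiable_entireFactor hz).continuous.continuousAt
  exact continuousAt_const.div (by fun_prop) (sin_pi_mul_ne_zero hs)

theorem continuous_mlIntegrand_horizontal (hz : z ≠ 0) {y : ℝ} (hy : y ≠ 0) :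
    Continuous fun x : ℝ => mlIntegrand δ γ z (x + y * I) := by
  refine continuous_iff_continuousAt.2 fun x => ?_
  exact ContinuousAt.comp (f := fun x : ℝ => (x + y * I : ℂ))
    (continuousAt_mlIntegrand hz (ne_intCast_of_im_ne_zero (by simpa using hy))) (by fun_prop)

theorem norm_cpow_neg (hz : z ≠ 0) (x y : ℝ) :
    ‖z ^ (-(x + y * I : ℂ))‖ = Real.exp (-(x * Real.log ‖z‖) + y * arg z) := by
  rw [cpow_def_of_ne_zero hz, norm_exp]
  simp [log_re, log_im]
  ring

theorem norm_entireFactor_le (hγ : 0 < γ) (hz : z ≠ 0) (c B : ℝ) :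
    ∃ C : ℝ, 0 ≤ C ∧ ∀ x y : ℝ, x ≤ c → |y| ≤ B →
      ‖entireFactor δ γ z (x + y * I)‖ ≤ C * Real.exp x := by
  -- Moving from `c` to `x` shifts the Gamma argument by `γ (c - x)`. This rate cancels `|z| ^ (-x)`
  -- and leaves a spare `e^x`.
  obtain ⟨C, hC, h⟩ := norm_inv_Gamma_add_le_of_im_le (1 + δ.re - γ * c)
    ((Real.log ‖z‖ + 1) / γ) (|δ.im| + γ * B)
  refine ⟨C * Real.exp (-c - c * Real.log ‖z‖ + B * Real.pi), by positivity, fun x y hx hy => ?_⟩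
  have h1 := h (1 + δ - γ * (c + y * I)) (by simp) (by
    have : (1 + δ - γ * (c + y * I)).im = δ.im - γ * y := by simp
    rw [this]
    refine (abs_sub _ _).trans ?_
    rw [abs_mul, abs_of_pos hγ]
    gcongr) (γ * (c - x)) (mul_nonneg hγ.le (sub_nonneg.2 hx))
  have e : 1 + δ - γ * (c + y * I) + ((γ * (c - x) : ℝ) : ℂ) = 1 + δ - γ * (x + y * I) := by
    push_cast; ring
  rw [e] at h1
  have hyz : y * arg z ≤ B * Real.pi := by
    refine (le_abs_self _).trans ?_
    rw [abs_mul]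
    exact mul_le_mul hy (abs_arg_le_pi z) (abs_nonneg _) ((abs_nonneg y).trans hy)
  rw [entireFactor, norm_mul, norm_cpow_neg hz]
  calc _ ≤ C * Real.exp (-((Real.log ‖z‖ + 1) / γ * (γ * (c - x)))) *
        Real.exp (-(x * Real.log ‖z‖) + y * arg z) := by gcongr
    _ = C * Real.exp (-((Real.log ‖z‖ + 1) * (c - x)) + (-(x * Real.log ‖z‖) + y * arg z)) := by
        rw [mul_assoc, ← Real.exp_add]; congr 3; field_simp
    _ ≤ C * Real.exp (-c - c * Real.log ‖z‖ + B * Real.pi + x) := by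
        refine mul_le_mul_of_nonneg_left (Real.exp_le_exp.2 ?_) hC
        linarith
    _ = _ := by rw [Real.exp_add]; ring

theorem norm_entireFactor_le_mul (hγ : 0 < γ) (hz : z ≠ 0) (c : ℝ) :
    ∃ C : ℝ, 0 ≤ C ∧ ∀ x y : ℝ, x ≤ c → 1 ≤ |δ.im - γ * y| →
      ‖entireFactor δ γ z (x + y * I)‖ ≤ C * Real.exp x * ‖entireFactor δ γ z (c + y * I)‖ := by
  obtain ⟨C, hC, h⟩ := norm_inv_Gamma_add_le_of_one_le_im (1 + δ.re - γ * c)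
    ((Real.log ‖z‖ + 1) / γ)
  refine ⟨C * Real.exp (-c), by positivity, fun x y hx hy => ?_⟩
  have h1 := h (1 + δ - γ * (c + y * I)) (by simp) (by simpa using hy)
    (γ * (c - x)) (mul_nonneg hγ.le (sub_nonneg.2 hx))
  have e : 1 + δ - γ * (c + y * I) + ((γ * (c - x) : ℝ) : ℂ) = 1 + δ - γ * (x + y * I) := by
    push_cast; ring
  rw [e] at h1
  rw [entireFactor, entireFactor, norm_mul, norm_mul, norm_cpow_neg hz, norm_cpow_neg hz]
  set G := ‖(Gamma (1 + δ - γ * (c + y * I)))⁻¹‖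
  calc _ ≤ C * Real.exp (-((Real.log ‖z‖ + 1) / γ * (γ * (c - x)))) * G *
        Real.exp (-(x * Real.log ‖z‖) + y * arg z) := by gcongr
    _ = C * G * Real.exp (-((Real.log ‖z‖ + 1) / γ * (γ * (c - x))) +
          (-(x * Real.log ‖z‖) + y * arg z)) := by
        rw [Real.exp_add (-((Real.log ‖z‖ + 1) / γ * (γ * (c - x))))]; ring
    _ = C * G * Real.exp (-c + x + (-(c * Real.log ‖z‖) + y * arg z)) := by
        congr 2; field_simp; ring
    _ = _ := by rw [Real.exp_add (-c + x), Real.exp_add (-c)]; ring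

theorem abs_sinh_pos {y : ℝ} (hy : y ≠ 0) : 0 < |Real.sinh (Real.pi * y)| :=
  abs_pos.2 (Real.sinh_eq_zero.not.2 (mul_ne_zero Real.pi_ne_zero hy))

theorem norm_mlIntegrand_le (hγ : 0 < γ) (hz : z ≠ 0) (c : ℝ) {y : ℝ} (hy : y ≠ 0) :
    ∃ C : ℝ, ∀ x : ℝ, x ≤ c → ‖mlIntegrand δ γ z (x + y * I)‖ ≤ C * Real.exp x := by
  obtain ⟨C, hC, h⟩ := norm_entireFactor_le (δ := δ) hγ hz c |y|
  refine ⟨Real.pi / |Real.sinh (Real.pi * y)| * C, fun x hx => ?_⟩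
  have h1 := abs_sinh_im_le_norm_sin (Real.pi * (x + y * I))
  rw [im_ofReal_mul] at h1
  simp only [add_im, ofReal_im, mul_im, ofReal_re, I_im, mul_one, I_re, mul_zero, add_zero,
    zero_add] at h1
  have h0 := abs_sinh_pos hy
  rw [mlIntegrand, norm_mul, norm_div, norm_real, Real.norm_of_nonneg Real.pi_pos.le, mul_assoc]
  gcongr
  exact h x y hx le_rfl

theorem integrableOn_mlIntegrand_Iic (hγ : 0 < γ) (hz : z ≠ 0) (c : ℝ) {y : ℝ} (hy : y ≠ 0) :
    IntegrableOn (fun x : ℝ => mlIntegrand δ γ z (x + y * I)) (Iic c) := by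
  obtain ⟨C, h⟩ := norm_mlIntegrand_le (δ := δ) hγ hz c hy
  refine Integrable.mono' ((integrableOn_exp_Iic c).const_mul C)
    (continuous_mlIntegrand_horizontal hz hy).aestronglyMeasurable ?_
  filter_upwards [ae_restrict_mem measurableSet_Iic] with x hx using h x hx

/-- Controls a horizontal ray by its endpoint, uniformly in the height. For `|y| ≥ 1` the sines at
equal height have comparable moduli, with ratio at most `2`. -/
theorem norm_mlIntegrand_le_mul (hγ : 0 < γ) (hz : z ≠ 0) (c : ℝ) :
    ∃ C : ℝ, 0 ≤ C ∧ ∀ x y : ℝ, x ≤ c → 1 ≤ |y| → 1 ≤ |δ.im - γ * y| →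
      ‖mlIntegrand δ γ z (x + y * I)‖ ≤ C * Real.exp x * ‖mlIntegrand δ γ z (c + y * I)‖ := by
  obtain ⟨C, hC, h⟩ := norm_entireFactor_le_mul (δ := δ) hγ hz c
  refine ⟨2 * C, by positivity, fun x y hx hy1 hy2 => ?_⟩
  have hy0 : y ≠ 0 := by rintro rfl; norm_num at hy1
  have him (t : ℝ) : ((Real.pi : ℂ) * (t + y * I)).im = Real.pi * y := by
    rw [im_ofReal_mul]; simp
  have h1 := abs_sinh_im_le_norm_sin (Real.pi * (x + y * I))
  have h2 := norm_sin_le_cosh_im (Real.pi * (c + y * I))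
  have h3 := abs_sinh_im_le_norm_sin (Real.pi * (c + y * I))
  rw [him] at h1 h2 h3
  have h4 : Real.cosh (Real.pi * y) ≤ 2 * |Real.sinh (Real.pi * y)| := by
    refine cosh_le_two_mul_abs_sinh ?_
    rw [abs_mul, abs_of_pos Real.pi_pos]
    nlinarith [Real.pi_gt_three]
  have h0 := abs_sinh_pos hy0
  have h5 : (‖sin (Real.pi * (x + y * I))‖)⁻¹ ≤ 2 * (‖sin (Real.pi * (c + y * I))‖)⁻¹ := by
    rw [inv_le_iff_one_le_mul₀ (h0.trans_le h1), mul_right_comm, ← div_eq_mul_inv,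
      one_le_div (h0.trans_le h3)]
    linarith
  rw [mlIntegrand, mlIntegrand, norm_mul, norm_mul, norm_div, norm_div, norm_real,
    Real.norm_of_nonneg Real.pi_pos.le]
  simp only [div_eq_mul_inv]
  calc _ ≤ Real.pi * (2 * (‖sin (Real.pi * (c + y * I))‖)⁻¹) *
        (C * Real.exp x * ‖entireFactor δ γ z (c + y * I)‖) := by
          gcongr
          exact h x y hx hy2
    _ = _ := by ring

end

open Filter Topology

/-! ### Residue theorem on rectangles -/

/-- The integral over the boundary of the rectangle `[a, b] × [φ₁, φ₂]`, counterclockwise. -/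
noncomputable def rectIntegral (f : ℂ → ℂ) (φ₁ φ₂ a b : ℝ) : ℂ :=
  (∫ x in a..b, f (x + φ₁ * I)) - (∫ x in a..b, f (x + φ₂ * I)) +
    I * (∫ y in φ₁..φ₂, f (b + y * I)) - I * (∫ y in φ₁..φ₂, f (a + y * I))

theorem add_mul_I_sub_mem_slitPlane {x y p : ℝ} (h : p < x ∨ y ≠ 0) :
    (x + y * I - p : ℂ) ∈ slitPlane := by
  rw [mem_slitPlane_iff]
  rcases h with h | h
  · left; simpa using h
  · right; simpa using h

theorem integral_inv_horizontal {a b φ : ℝ} (p : ℝ) (h : φ ≠ 0) :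
    ∫ x in a..b, (x + φ * I - p : ℂ)⁻¹ = log (b + φ * I - p) - log (a + φ * I - p) := by
  have hc : Continuous fun x : ℝ => (x + φ * I - p : ℂ)⁻¹ :=
    Continuous.inv₀ (by fun_prop) fun x =>
      slitPlane_ne_zero (add_mul_I_sub_mem_slitPlane (Or.inr h))
  refine intervalIntegral.integral_eq_sub_of_hasDerivAt (f := fun x : ℝ => log (x + φ * I - p))
    (fun x _ => ?_) (hc.intervalIntegrable _ _)
  have hd : HasDerivAt (fun x : ℝ => (x + φ * I - p : ℂ)) 1 x :=
    ((hasDerivAt_id x).ofReal_comp.add_const _).sub_const _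
  simpa using hd.clog_real (add_mul_I_sub_mem_slitPlane (Or.inr h))

theorem integral_inv_vertical_right {b φ₁ φ₂ p : ℝ} (h : p < b) :
    I * ∫ y in φ₁..φ₂, (b + y * I - p : ℂ)⁻¹ = log (b + φ₂ * I - p) - log (b + φ₁ * I - p) := by
  have hc : Continuous fun y : ℝ => (b + y * I - p : ℂ)⁻¹ :=
    Continuous.inv₀ (by fun_prop) fun x =>
      slitPlane_ne_zero (add_mul_I_sub_mem_slitPlane (Or.inl h))
  rw [← intervalIntegral.integral_const_mul]
  refine intervalIntegral.integral_eq_sub_of_hasDerivAt (f := fun y : ℝ => log (b + y * I - p))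
    (fun y _ => ?_) ((hc.intervalIntegrable _ _).const_mul _)
  have hd : HasDerivAt (fun y : ℝ => (b + y * I - p : ℂ)) I y := by
    simpa using (((hasDerivAt_id y).ofReal_comp.mul_const I).const_add (b : ℂ)).sub_const (p : ℂ)
  simpa [div_eq_mul_inv] using hd.clog_real (add_mul_I_sub_mem_slitPlane (Or.inl h))

/-- The left side crosses the cut of `log (s - p)`, so the primitive is `log (-(s - p))`; a
half-turn reduces to the right side. -/
theorem integral_inv_vertical_left {a φ₁ φ₂ p : ℝ} (h : a < p) :
    I * ∫ y in φ₁..φ₂, (a + y * I - p : ℂ)⁻¹ =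
      log (-(a + φ₂ * I - p)) - log (-(a + φ₁ * I - p)) := by
  have key := integral_inv_vertical_right (b := -a) (p := -p) (φ₁ := -φ₁) (φ₂ := -φ₂)
    (neg_lt_neg h)
  have h1 := intervalIntegral.integral_comp_neg (a := φ₁) (b := φ₂)
    (fun y : ℝ => (((-a : ℝ) : ℂ) + y * I - ((-p : ℝ) : ℂ))⁻¹)
  rw [intervalIntegral.integral_symm, ← h1, mul_neg, ← mul_neg, ← intervalIntegral.integral_neg] at key
  have e (y : ℝ) : (((-a : ℝ) : ℂ) + ((-y : ℝ) : ℂ) * I - ((-p : ℝ) : ℂ)) = -(a + y * I - p) := by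
    push_cast; ring
  simp only [e, inv_neg, neg_neg] at key
  exact key

theorem log_sub_log_neg_of_im_pos {s : ℂ} (hs : 0 < s.im) :
    log s - log (-s) = Real.pi * I := by
  simp only [log, norm_neg, arg_neg_eq_arg_sub_pi_of_im_pos hs]
  push_cast; ring

theorem log_sub_log_neg_of_im_neg {s : ℂ} (hs : s.im < 0) :
    log s - log (-s) = -(Real.pi * I) := by
  simp only [log, norm_neg, arg_neg_eq_arg_add_pi_of_im_neg hs]
  push_cast; ring

/-- The logarithms cancel at the right corners. At the left ones the two branches differ by `πi`
above and `-πi` below, which together make `2πi`. -/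
theorem rectIntegral_inv_sub {φ₁ φ₂ a b p : ℝ} (h₁ : φ₁ < 0) (h₂ : 0 < φ₂) (ha : a < p)
    (hb : p < b) : rectIntegral (fun s => (s - p)⁻¹) φ₁ φ₂ a b = 2 * Real.pi * I := by
  rw [rectIntegral, integral_inv_horizontal p h₁.ne, integral_inv_horizontal p h₂.ne',
    integral_inv_vertical_right hb, integral_inv_vertical_left ha]
  have e1 := log_sub_log_neg_of_im_pos (s := a + φ₂ * I - p) (by simpa)
  have e2 := log_sub_log_neg_of_im_neg (s := a + φ₁ * I - p) (by simpa)
  linear_combination e1 - e2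

/-- The residue theorem for a simple pole `p` in a rectangle. -/
theorem rectIntegral_div_sub {φ₁ φ₂ a b p : ℝ} (h₁ : φ₁ < 0) (h₂ : 0 < φ₂) (ha : a < p)
    (hb : p < b) {F : ℂ → ℂ} {U : Set ℂ} (hU : IsOpen U)
    (hsub : (uIcc a b) ×ℂ (uIcc φ₁ φ₂) ⊆ U) (hF : DifferentiableOn ℂ F U) :
    rectIntegral (fun s => F s / (s - p)) φ₁ φ₂ a b = 2 * Real.pi * I * F p := by
  have hmem (x y : ℝ) (hx : x ∈ uIcc a b) (hy : y ∈ uIcc φ₁ φ₂) : (x + y * I : ℂ) ∈ U := by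
    refine hsub ?_
    rw [mem_reProdIm]
    simpa using ⟨hx, hy⟩
  have hpU : (p : ℂ) ∈ U := by
    have := hmem p 0 (by rw [uIcc_of_le (ha.trans hb).le]; exact ⟨ha.le, hb.le⟩)
      (by rw [uIcc_of_le (h₁.trans h₂).le]; exact ⟨h₁.le, h₂.le⟩)
    simpa using this
  -- `F s / (s - p)` is `F p / (s - p)` plus the slope of `F`; the slope extends holomorphically
  -- across `p`, so its boundary integral vanishes.
  have hD : DifferentiableOn ℂ (dslope F p) U :=
    (differentiableOn_dslope (hU.mem_nhds hpU)).2 hF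
  have hzero := integral_boundary_rect_eq_zero_of_differentiableOn (dslope F p) (a + φ₁ * I)
    (b + φ₂ * I) (by simpa using hD.mono hsub)
  simp only [add_re, ofReal_re, mul_re, I_re, mul_zero, ofReal_im, I_im, mul_one, sub_self,
    add_zero, add_im, mul_im, zero_add, smul_eq_mul] at hzero
  have heq (s : ℂ) (hs : s ≠ p) : F s / (s - p) = F p * (s - p)⁻¹ + dslope F p s := by
    have hs' := sub_ne_zero.2 hs
    rw [dslope_of_ne F hs, slope_def_field]
    field_simp
    ring
  have hne (x y : ℝ) (h : x ≠ p ∨ y ≠ 0) : (x + y * I : ℂ) ≠ p := by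
    intro hxy
    rcases h with h | h
    · exact h (by simpa using congrArg re hxy)
    · exact h (by simpa using congrArg im hxy)
  have hor (φ : ℝ) (hφ : φ ≠ 0) (hφ' : φ ∈ uIcc φ₁ φ₂) :
      ∫ x in a..b, F (x + φ * I) / (x + φ * I - p) =
        F p * (∫ x in a..b, (x + φ * I - p : ℂ)⁻¹) + ∫ x in a..b, dslope F p (x + φ * I) := by
    rw [← intervalIntegral.integral_const_mul, ← intervalIntegral.integral_add]
    · exact intervalIntegral.integral_congr fun x _ => heq _ (hne x φ (Or.inr hφ))
    · refine Continuous.intervalIntegrable (continuous_const.mul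
        (Continuous.inv₀ (by fun_prop) fun x => sub_ne_zero.2 (hne x φ (Or.inr hφ)))) _ _
    · refine ContinuousOn.intervalIntegrable ?_
      exact hD.continuousOn.comp (f := fun x : ℝ => (x + φ * I : ℂ)) (by fun_prop)
        fun x hx => hmem x φ hx hφ'
  have ver (x : ℝ) (hx : x ≠ p) (hx' : x ∈ uIcc a b) :
      ∫ y in φ₁..φ₂, F (x + y * I) / (x + y * I - p) =
        F p * (∫ y in φ₁..φ₂, (x + y * I - p : ℂ)⁻¹) + ∫ y in φ₁..φ₂, dslope F p (x + y * I) := by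
    rw [← intervalIntegral.integral_const_mul, ← intervalIntegral.integral_add]
    · exact intervalIntegral.integral_congr fun y _ => heq _ (hne x y (Or.inl hx))
    · refine Continuous.intervalIntegrable (continuous_const.mul
        (Continuous.inv₀ (by fun_prop) fun y => sub_ne_zero.2 (hne x y (Or.inl hx)))) _ _
    · refine ContinuousOn.intervalIntegrable ?_
      exact hD.continuousOn.comp (f := fun y : ℝ => (x + y * I : ℂ)) (by fun_prop)
        fun y hy => hmem x y hx' hy
  have hinv := rectIntegral_inv_sub h₁ h₂ ha hb
  rw [rectIntegral] at hinv
  rw [rectIntegral, hor φ₁ h₁.ne left_mem_uIcc, hor φ₂ h₂.ne' right_mem_uIcc,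
    ver b hb.ne' right_mem_uIcc, ver a ha.ne left_mem_uIcc]
  linear_combination F p * hinv + hzero

/-! ### Residues and left loops -/

section

variable {δ z : ℂ} {γ : ℝ}

/-- Dividing `sin (π s) / π` by its zero at `p = -k` leaves a function without zeros in the strip
`|Re s - p| < 1`, with value `cos (π k) = (-1) ^ k` at `p`. -/
theorem rectIntegral_mlIntegrand_single (hz : z ≠ 0) {φ₁ φ₂ a b : ℝ} (h₁ : φ₁ < 0) (h₂ : 0 < φ₂)
    (k : ℕ) (ha : a ∈ Ioo (-(k : ℝ) - 1) (-k)) (hb : b ∈ Ioo (-(k : ℝ)) (-k + 1)) :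
    rectIntegral (mlIntegrand δ γ z) φ₁ φ₂ a b =
      2 * Real.pi * I * ((-1) ^ k * entireFactor δ γ z (-k)) := by
  have hpi : (Real.pi : ℂ) ≠ 0 := ofReal_ne_zero.2 Real.pi_ne_zero
  set S : ℂ → ℂ := fun s => sin (Real.pi * s) / Real.pi with hS
  set p : ℝ := -k with hp
  have hSd : Differentiable ℂ S := by simp only [hS]; fun_prop
  have hSp : S p = 0 := by
    have : sin (Real.pi * (p : ℂ)) = 0 := by
      rw [sin_eq_zero_iff]; exact ⟨-k, by simp only [hp]; push_cast; ring⟩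
    simp only [hS, this, zero_div]
  have hDd : Differentiable ℂ (dslope S p) := fun s =>
    ((differentiableOn_dslope (univ_mem)).2 hSd.differentiableOn).differentiableAt univ_mem
  have hfac (s : ℂ) : (s - p) * dslope S p s = S s := by
    have := sub_smul_dslope S (p : ℂ) s
    rwa [hSp, sub_zero, smul_eq_mul] at this
  have hDp : dslope S p p = (-1) ^ k := by
    rw [dslope_same]
    have h : HasDerivAt S (cos (Real.pi * p) * (Real.pi * 1) / Real.pi) p :=
      (((hasDerivAt_id (p : ℂ)).const_mul (Real.pi : ℂ)).csin).div_const _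
    rw [h.deriv, mul_one, mul_div_cancel_right₀ _ hpi, hp]
    push_cast
    rw [mul_neg, Complex.cos_neg, mul_comm]
    exact_mod_cast congrArg ofReal (Real.cos_nat_mul_pi k)
  set U : Set ℂ := {s | s.re ∈ Ioo (p - 1) (p + 1)} with hU
  have hUo : IsOpen U := isOpen_Ioo.preimage continuous_re
  have hDne (s : ℂ) (hs : s ∈ U) : dslope S p s ≠ 0 := by
    by_cases hsp : s = p
    · rw [hsp, hDp]; exact pow_ne_zero _ (by norm_num)
    · intro h0
      have h1 := hfac s
      rw [h0, mul_zero] at h1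
      have h2 : sin (Real.pi * s) = 0 := by
        rcases div_eq_zero_iff.1 h1.symm with h | h
        · exact h
        · exact absurd h hpi
      refine sin_pi_mul_ne_zero (s := s) (fun m hm => hsp ?_) h2
      have hm' : s.re = m := by rw [hm, intCast_re]
      obtain ⟨h3, h4⟩ := hs
      rw [hm', hp] at h3 h4
      have h3' : -(k : ℤ) - 1 < m := by exact_mod_cast h3
      have h4' : m < -(k : ℤ) + 1 := by exact_mod_cast h4
      have : m = -k := by omega
      rw [hm, this, hp]; push_cast; rfl
  have hF : DifferentiableOn ℂ (fun s => entireFactor δ γ z s / dslope S p s) U :=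
    (differentiable_entireFactor hz).differentiableOn.div hDd.differentiableOn hDne
  have hsub : (uIcc a b) ×ℂ (uIcc φ₁ φ₂) ⊆ U := by
    intro s hs
    rw [mem_reProdIm, uIcc_of_le (ha.2.trans hb.1).le] at hs
    exact ⟨ha.1.trans_le hs.1.1, hs.1.2.trans_lt hb.2⟩
  have hfun : mlIntegrand δ γ z = fun s => entireFactor δ γ z s / dslope S p s / (s - p) := by
    ext s
    rw [div_div, mul_comm (dslope S p s), hfac, mlIntegrand]
    simp only [hS]
    rw [div_div_eq_mul_div]
    ring
  rw [hfun, rectIntegral_div_sub h₁ h₂ ha.2 hb.1 hUo hsub hF, hDp, hp]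
  have hsq : ((-1 : ℂ) ^ k) * (-1) ^ k = 1 := by rw [← mul_pow]; simp
  have : ((-1 : ℂ) ^ k)⁻¹ = (-1) ^ k := inv_eq_of_mul_eq_one_left hsq
  rw [div_eq_mul_inv, this]
  push_cast
  ring

theorem rectIntegral_add_adjacent {f : ℂ → ℂ} {φ₁ φ₂ a b c : ℝ}
    (h₁ : Continuous fun x : ℝ => f (x + φ₁ * I)) (h₂ : Continuous fun x : ℝ => f (x + φ₂ * I)) :
    rectIntegral f φ₁ φ₂ a b + rectIntegral f φ₁ φ₂ b c = rectIntegral f φ₁ φ₂ a c := by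
  simp only [rectIntegral]
  rw [← intervalIntegral.integral_add_adjacent_intervals (h₁.intervalIntegrable a b)
      (h₁.intervalIntegrable b c), ← intervalIntegral.integral_add_adjacent_intervals
      (h₂.intervalIntegrable a b) (h₂.intervalIntegrable b c)]
  ring

theorem rectIntegral_mlIntegrand (hz : z ≠ 0) {φ₁ φ₂ c : ℝ} (h₁ : φ₁ < 0) (h₂ : 0 < φ₂)
    (hc : c ∈ Ioo (0 : ℝ) 1) (N : ℕ) :
    rectIntegral (mlIntegrand δ γ z) φ₁ φ₂ (c - N) c =
      2 * Real.pi * I * ∑ k ∈ Finset.range N, (-1) ^ k * entireFactor δ γ z (-k) := by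
  obtain ⟨hc0, hc1⟩ := hc
  induction N with
  | zero => simp [rectIntegral]
  | succ N ih =>
    rw [← rectIntegral_add_adjacent (b := c - N) (continuous_mlIntegrand_horizontal hz h₁.ne)
      (continuous_mlIntegrand_horizontal hz h₂.ne'), ih,
      rectIntegral_mlIntegrand_single hz h₁ h₂ N ⟨by push_cast; linarith, by push_cast; linarith⟩
        ⟨by linarith, by linarith⟩, Finset.sum_range_succ]
    ring

theorem summable_residues (hγ : 0 < γ) (hz : z ≠ 0) :
    Summable fun k : ℕ => (-1) ^ k * entireFactor δ γ z (-k) := by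
  obtain ⟨C, -, h⟩ := norm_entireFactor_le (δ := δ) hγ hz 0 0
  refine Summable.of_norm_bounded (g := fun k : ℕ => C * Real.exp (-1) ^ k)
    ((summable_geometric_of_lt_one (Real.exp_pos _).le (by simp)).mul_left C) fun k => ?_
  have := h (-k) 0 (by simp) (by simp)
  rw [← Real.exp_nat_mul]
  simpa using this

/-- Integer shifts preserve `|sin (π s)|`, so the sine factor is bounded independently of `N`, while
the entire factor is `O(e^(c - N))`. -/
theorem tendsto_vertical_mlIntegrand (hγ : 0 < γ) (hz : z ≠ 0) {φ₁ φ₂ c : ℝ}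
    (hc : c ∈ Ioo (0 : ℝ) 1) :
    Tendsto (fun N : ℕ => ∫ y in φ₁..φ₂, mlIntegrand δ γ z ((c - N : ℝ) + y * I)) atTop
      (𝓝 0) := by
  set B := max |φ₁| |φ₂|
  obtain ⟨C, hC, h⟩ := norm_entireFactor_le (δ := δ) hγ hz c B
  have hcont : Continuous fun y : ℝ => (Real.pi / sin (Real.pi * (c + y * I)) : ℂ) := by
    refine continuous_const.div (by fun_prop) fun y => ?_
    exact sin_pi_mul_ne_zero (ne_intCast_of_re_mem_Ioo 0 (by simpa using hc))
  obtain ⟨D, hD⟩ := (isCompact_uIcc (a := φ₁) (b := φ₂)).exists_bound_of_continuousOn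
    hcont.continuousOn
  have hbound (N : ℕ) : ‖∫ y in φ₁..φ₂, mlIntegrand δ γ z ((c - N : ℝ) + y * I)‖ ≤
      D * (C * Real.exp (c - N)) * |φ₂ - φ₁| := by
    refine intervalIntegral.norm_integral_le_of_norm_le_const fun y hy => ?_
    have hy' : y ∈ uIcc φ₁ φ₂ := uIoc_subset_uIcc hy
    have hyB : |y| ≤ B := by
      rcases mem_uIcc.1 hy' with ⟨h3, h4⟩ | ⟨h3, h4⟩
      · exact abs_le_max_abs_abs h3 h4
      · exact (abs_le_max_abs_abs h3 h4).trans_eq (max_comm _ _)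
    have hsin : ‖sin (Real.pi * ((c - N : ℝ) + y * I))‖ = ‖sin (Real.pi * (c + y * I))‖ := by
      have : (Real.pi * ((c - N : ℝ) + y * I) : ℂ) = Real.pi * (c + y * I) - N * Real.pi := by
        push_cast; ring
      rw [this, Complex.sin_antiperiodic.sub_nat_mul_eq]
      simp
    have hDy := hD y hy'
    rw [norm_div] at hDy
    rw [mlIntegrand, norm_mul, norm_div, hsin]
    exact mul_le_mul hDy (h _ _ (by simp) hyB) (norm_nonneg _)
      ((by positivity : (0:ℝ) ≤ _).trans hDy)
  refine squeeze_zero_norm hbound ?_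
  have : Tendsto (fun N : ℕ => Real.exp (c - N)) atTop (𝓝 0) :=
    Real.tendsto_exp_atBot.comp
      (tendsto_atBot_add_const_left _ c (tendsto_neg_atTop_atBot.comp tendsto_natCast_atTop_atTop))
  simpa using ((this.const_mul C).const_mul D).mul_const |φ₂ - φ₁|

theorem integral_leftLoop_mlIntegrand (hγ : 0 < γ) (hz : z ≠ 0) {φ₁ φ₂ c : ℝ} (h₁ : φ₁ < 0)
    (h₂ : 0 < φ₂) (hc : c ∈ Ioo (0 : ℝ) 1) :
    (Contour.leftLoop c φ₁ φ₂).integral (mlIntegrand δ γ z) =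
      2 * Real.pi * I * ∑' k : ℕ, (-1) ^ k * entireFactor δ γ z (-k) := by
  have hbot : Tendsto (fun N : ℕ => c - N) atTop atBot :=
    tendsto_atBot_add_const_left _ c (tendsto_neg_atTop_atBot.comp tendsto_natCast_atTop_atTop)
  have hlim (φ : ℝ) (hφ : φ ≠ 0) := intervalIntegral_tendsto_integral_Iic c
    (integrableOn_mlIntegrand_Iic (δ := δ) hγ hz c hφ) hbot
  have hL := (((hlim φ₁ h₁.ne).sub (hlim φ₂ h₂.ne')).add_const
    (I * ∫ y in φ₁..φ₂, mlIntegrand δ γ z (c + y * I))).sub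
    ((tendsto_vertical_mlIntegrand (δ := δ) (φ₁ := φ₁) (φ₂ := φ₂) hγ hz hc).const_mul I)
  have hR := ((summable_residues (δ := δ) hγ hz).hasSum.tendsto_sum_nat).const_mul
    (2 * Real.pi * I)
  have hEq := tendsto_nhds_unique (hL.congr fun N => rectIntegral_mlIntegrand hz h₁ h₂ hc N) hR
  rw [← hEq, Contour.integral]
  ring

/-! ### Vertical lines -/

/-- If the integral over a vertical line converges, it agrees with that over the left loops. -/
theorem integral_vertical_mlIntegrand (hγ : 0 < γ) (hz : z ≠ 0) {c : ℝ}
    (hc : c ∈ Ioo (0 : ℝ) 1) (hconv : (Contour.vertical c).Converges (mlIntegrand δ γ z)) :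
    (Contour.vertical c).integral (mlIntegrand δ γ z) =
      2 * Real.pi * I * ∑' k : ℕ, (-1) ^ k * entireFactor δ γ z (-k) := by
  set V := 2 * Real.pi * I * ∑' k : ℕ, (-1) ^ k * entireFactor δ γ z (-k)
  set f := mlIntegrand δ γ z
  obtain ⟨C, hC, h⟩ := norm_mlIntegrand_le_mul (δ := δ) hγ hz c
  replace hconv : Integrable fun t : ℝ => f (c + t * I) := hconv
  set M : ℝ := C * Real.exp c
  set E : ℝ → ℝ := fun T => M * (‖f (c + T * I)‖ + ‖f (c + (-T : ℝ) * I)‖) with hE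
  have hEint : Integrable E := (hconv.norm.add hconv.comp_neg.norm).const_mul M
  have hhor (y : ℝ) (hy1 : 1 ≤ |y|) (hy2 : 1 ≤ |δ.im - γ * y|) :
      ‖∫ x in Iic c, f (x + y * I)‖ ≤ M * ‖f (c + y * I)‖ := by
    calc ‖∫ x in Iic c, f (x + y * I)‖
        ≤ ∫ x in Iic c, C * Real.exp x * ‖f (c + y * I)‖ := by
          refine norm_integral_le_of_norm_le
            (((integrableOn_exp_Iic c).const_mul C).mul_const _) ?_
          filter_upwards [ae_restrict_mem measurableSet_Iic] with x hx using h x y hx hy1 hy2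
      _ = _ := by rw [integral_mul_const, integral_const_mul, integral_exp_Iic]
  -- The left loop at heights `±T` has the value `V` for every `T > 0`; removing its vertical side
  -- leaves the two rays.
  have hbd : ∀ᶠ T : ℝ in atTop, ‖V - I * ∫ y in (-T)..T, f (c + y * I)‖ ≤ E T := by
    filter_upwards [eventually_ge_atTop 1, eventually_ge_atTop ((1 + |δ.im|) / γ)] with T hT1 hT2
    have hT0 : 0 < T := by linarith
    rw [div_le_iff₀ hγ] at hT2
    have hd := abs_le.1 (le_refl |δ.im|)
    have e := integral_leftLoop_mlIntegrand (δ := δ) hγ hz (neg_lt_zero.2 hT0) hT0 hc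
    rw [Contour.integral] at e
    have b1 := hhor T (by rwa [abs_of_pos hT0])
      (by rw [abs_sub_comm]; exact le_trans (by linarith) (le_abs_self _))
    have b2 := hhor (-T) (by rwa [abs_neg, abs_of_pos hT0])
      (le_trans (by linarith) (le_abs_self _))
    have e' : V - I * ∫ y in (-T)..T, f (c + y * I) =
        (∫ x in Iic c, f (x + (-T : ℝ) * I)) - ∫ x in Iic c, f (x + T * I) := by
      linear_combination -e
    rw [e']
    refine (norm_sub_le _ _).trans ?_
    simp only [hE]
    linarith
  have hlim : Tendsto (fun T : ℝ => ‖V - I * ∫ y in (-T)..T, f (c + y * I)‖) atTop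
      (𝓝 ‖V - I * ∫ y : ℝ, f (c + y * I)‖) :=
    (((intervalIntegral_tendsto_integral hconv tendsto_neg_atTop_atBot tendsto_id).const_mul
      I).const_sub V).norm
  -- Otherwise the integrable `E` would stay above a positive constant on a half-line.
  have hzero : ‖V - I * ∫ y : ℝ, f (c + y * I)‖ = 0 := by
    by_contra hne
    have hpos : 0 < ‖V - I * ∫ y : ℝ, f (c + y * I)‖ := lt_of_le_of_ne (norm_nonneg _) (Ne.symm hne)
    set ε := ‖V - I * ∫ y : ℝ, f (c + y * I)‖ / 2
    have hε : 0 < ε := half_pos hpos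
    have hev : ∀ᶠ T in atTop, ε ≤ E T := by
      filter_upwards [hbd, hlim.eventually (lt_mem_nhds (half_lt_self hpos))] with T h1 h2
      exact h2.le.trans h1
    obtain ⟨T₀, hT₀⟩ := eventually_atTop.1 hev
    have hfin : IntegrableOn (fun _ : ℝ => ε) (Ioi T₀) := by
      refine Integrable.mono' hEint.integrableOn aestronglyMeasurable_const ?_
      filter_upwards [ae_restrict_mem measurableSet_Ioi] with T hT
      rw [Real.norm_of_nonneg hε.le]
      exact hT₀ T (le_of_lt hT)
    rw [integrableOn_const_iff] at hfin
    simp [hε.ne'] at hfin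
  exact (sub_eq_zero.1 (norm_eq_zero.1 hzero)).symm

end

/-! ### Divergence of right loops -/

section

variable {δ z : ℂ} {γ : ℝ}

/-- Along a horizontal line the integrand does not decrease under the shift by `1 / γ`. -/
theorem norm_mlIntegrand_le_norm_shift (hγ : 0 < γ) (hz : z ≠ 0) {y : ℝ} (hy : y ≠ 0) :
    ∃ X : ℝ, ∀ x : ℝ, X ≤ x →
      ‖mlIntegrand δ γ z (x + y * I)‖ ≤ ‖mlIntegrand δ γ z ((x + 1 / γ : ℝ) + y * I)‖ := by
  have h0 := abs_sinh_pos hy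
  set K := Real.cosh (Real.pi * y) / |Real.sinh (Real.pi * y)|
  have hK : 0 ≤ K := div_nonneg (Real.cosh_pos _).le (abs_nonneg _)
  -- Beyond this point `γ x - δ.re ≥ K |z| ^ (1 / γ)`: the factor gained from `1/Γ` outweighs the
  -- losses from the sine and the power.
  refine ⟨(δ.re + K * Real.exp (1 / γ * Real.log ‖z‖)) / γ, fun x hx => ?_⟩
  rw [div_le_iff₀ hγ] at hx
  have him (t : ℝ) : ((Real.pi : ℂ) * (t + y * I)).im = Real.pi * y := by
    rw [im_ofReal_mul]; simp
  have h1 := abs_sinh_im_le_norm_sin (Real.pi * (x + y * I))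
  have h2 := norm_sin_le_cosh_im (Real.pi * ((x + 1 / γ : ℝ) + y * I))
  have h3 := abs_sinh_im_le_norm_sin (Real.pi * ((x + 1 / γ : ℝ) + y * I))
  rw [him] at h1 h2 h3
  set A := ‖sin (Real.pi * (x + y * I))‖
  set A' := ‖sin (Real.pi * ((x + 1 / γ : ℝ) + y * I))‖
  have hA : 0 < A := h0.trans_le h1
  have hA' : 0 < A' := h0.trans_le h3
  have hsin : A⁻¹ ≤ K * A'⁻¹ := by
    rw [inv_le_iff_one_le_mul₀ hA, mul_right_comm, ← div_eq_mul_inv, one_le_div hA']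
    calc A' ≤ K * |Real.sinh (Real.pi * y)| := by
          rw [div_mul_cancel₀ _ h0.ne']; exact h2
      _ ≤ K * A := by gcongr
  -- The shift by `1 / γ` lowers the Gamma argument by exactly `1`, so one use of the recursion
  -- suffices.
  have hG : (Gamma (1 + δ - γ * ((x + 1 / γ : ℝ) + y * I)))⁻¹ =
      (δ - γ * (x + 1 / γ : ℝ) - γ * y * I + 1) * (Gamma (1 + δ - γ * (x + y * I)))⁻¹ := by
    have hγ' : (γ : ℂ) ≠ 0 := ofReal_ne_zero.2 hγ.ne'
    rw [one_div_Gamma_eq_self_mul_one_div_Gamma_add_one]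
    have e : 1 + δ - γ * ((x + 1 / γ : ℝ) + y * I) + 1 = 1 + δ - γ * (x + y * I) := by
      push_cast; field_simp; ring
    rw [e]
    congr 1
    ring
  have hw : K * Real.exp (1 / γ * Real.log ‖z‖) ≤
      ‖δ - γ * (x + 1 / γ : ℝ) - γ * y * I + 1‖ := by
    refine le_trans ?_ (abs_re_le_norm _)
    have e : (δ - γ * (x + 1 / γ : ℝ) - γ * y * I + 1).re = δ.re - γ * x := by
      simp
      field_simp
      ring
    rw [e, abs_sub_comm]
    exact le_trans (by linarith) (le_abs_self _)
  rw [mlIntegrand, mlIntegrand, entireFactor, entireFactor, hG]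
  simp only [norm_mul, norm_div, norm_real, norm_cpow_neg hz, Real.norm_of_nonneg Real.pi_pos.le]
  set G := ‖(Gamma (1 + δ - γ * (x + y * I)))⁻¹‖
  set W := ‖δ - γ * (x + 1 / γ : ℝ) - γ * y * I + 1‖
  set P := Real.exp (-((x + 1 / γ) * Real.log ‖z‖) + y * arg z)
  have hP : Real.exp (-(x * Real.log ‖z‖) + y * arg z) = Real.exp (1 / γ * Real.log ‖z‖) * P := by
    rw [← Real.exp_add]; congr 1; ring
  rw [hP, div_eq_mul_inv, div_eq_mul_inv Real.pi]
  calc Real.pi * A⁻¹ * (G * (Real.exp (1 / γ * Real.log ‖z‖) * P))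
      ≤ Real.pi * (K * A'⁻¹) * (G * (Real.exp (1 / γ * Real.log ‖z‖) * P)) := by gcongr
    _ = Real.pi * A'⁻¹ * ((K * Real.exp (1 / γ * Real.log ‖z‖)) * G * P) := by ring
    _ ≤ Real.pi * A'⁻¹ * (W * G * P) := by gcongr

/-- Integrating `F x ≤ F (x + h)` over `(a, ∞)` would give `∫ F` over `(a, a + h)` at most `0`, yet
`F > 0`. The condition `hδ` keeps the ray off the zeros of `1/Γ`. -/
theorem not_integrableOn_mlIntegrand_Ici (hγ : 0 < γ) (hz : z ≠ 0) (c : ℝ) {y : ℝ} (hy : y ≠ 0)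
    (hδ : γ * y ≠ δ.im) :
    ¬ IntegrableOn (fun x : ℝ => mlIntegrand δ γ z (x + y * I)) (Ici c) := by
  intro hint
  obtain ⟨X, hX⟩ := norm_mlIntegrand_le_norm_shift (δ := δ) hγ hz hy
  set F : ℝ → ℝ := fun x => ‖mlIntegrand δ γ z (x + y * I)‖ with hF
  set a := max X c
  set h := 1 / γ
  have hh : 0 < h := one_div_pos.2 hγ
  have hFc : Continuous F := (continuous_mlIntegrand_horizontal hz hy).norm
  have hFpos (x : ℝ) : 0 < F x := by
    have hG : Gamma (1 + δ - γ * (x + y * I)) ≠ 0 := Gamma_ne_zero fun m hm => by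
      have := congrArg im hm
      simp only [sub_im, add_im, one_im, zero_add, ofReal_im, mul_im, ofReal_re,
        I_im, mul_one, I_re, mul_zero, add_zero, neg_im, natCast_im, neg_zero] at this
      exact hδ (by linarith)
    refine norm_pos_iff.2 (mul_ne_zero (div_ne_zero (ofReal_ne_zero.2 Real.pi_ne_zero) ?_)
      (mul_ne_zero (inv_ne_zero hG) ?_))
    · exact sin_pi_mul_ne_zero (ne_intCast_of_im_ne_zero (by simpa using hy))
    · exact norm_pos_iff.1 (by rw [norm_cpow_neg hz]; positivity)
  have hInt : IntegrableOn F (Ioi a) :=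
    IntegrableOn.mono_set (s := Ioi a) (t := Ici c) hint.norm fun x hx => (le_max_right X c).trans (le_of_lt hx)
  have hInt' : IntegrableOn F (Ioi (a + h)) :=
    hInt.mono_set (Ioi_subset_Ioi (by linarith))
  have hpre : (fun x => x + h) ⁻¹' Ioi (a + h) = Ioi a := by simp
  have hmp : MeasurePreserving (fun x : ℝ => x + h) := measurePreserving_add_right volume h
  have hme : MeasurableEmbedding fun x : ℝ => x + h := measurableEmbedding_addRight h
  have hshift : ∫ x in Ioi a, F (x + h) = ∫ x in Ioi (a + h), F x := by
    rw [← hpre]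
    exact hmp.setIntegral_preimage_emb hme F (Ioi (a + h))
  have hIntS : IntegrableOn (fun x => F (x + h)) (Ioi a) := by
    rw [← hpre]
    exact (hmp.integrableOn_comp_preimage hme).2 hInt'
  have hle : ∫ x in Ioi a, F x ≤ ∫ x in Ioi a, F (x + h) :=
    setIntegral_mono_on hInt hIntS measurableSet_Ioi
      fun x hx => hX x ((le_max_left X c).trans (le_of_lt hx))
  have hsplit : ∫ x in Ioi a, F x = (∫ x in a..(a + h), F x) + ∫ x in Ioi (a + h), F x :=
    (intervalIntegral.integral_interval_add_Ioi hInt hInt').symm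
  have hpos : 0 < ∫ x in a..(a + h), F x :=
    intervalIntegral.intervalIntegral_pos_of_pos (hFc.intervalIntegrable _ _) hFpos (by linarith)
  linarith

end

/-! ### Admissible contours and conclusion -/

theorem zero_mem_leftPoles (δ : ℂ) (γ : ℝ) :
    (0 : ℂ) ∈ leftPoles 1 ![((0 : ℂ), (1 : ℝ)), (-δ, γ)] :=
  ⟨0, by simp, 0, by simp⟩

theorem one_mem_rightPoles : (1 : ℂ) ∈ rightPoles 1 ![((0 : ℂ), (1 : ℝ))] :=
  ⟨0, by simp, 0, by simp⟩

theorem exists_eq_neg_of_mem_leftPoles {δ : ℂ} {γ : ℝ} {s : ℂ}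
    (hs : s ∈ leftPoles 1 ![((0 : ℂ), (1 : ℝ)), (-δ, γ)]) : ∃ k : ℕ, s = -k := by
  obtain ⟨j, hj, k, hk⟩ := hs
  have : j = 0 := by ext; simpa using hj
  subst this
  exact ⟨k, by simpa using hk⟩

theorem exists_eq_add_one_of_mem_rightPoles {s : ℂ}
    (hs : s ∈ rightPoles 1 ![((0 : ℂ), (1 : ℝ))]) : ∃ k : ℕ, s = k + 1 := by
  obtain ⟨j, hj, k, hk⟩ := hs
  have : j = 0 := by ext; simp
  subst this
  simp only [Matrix.cons_val_zero, ofReal_one, one_mul, sub_zero] at hk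
  exact ⟨k, by linear_combination -hk⟩

theorem separates_leftLoop (δ : ℂ) (γ : ℝ) :
    (Contour.leftLoop (1 / 2) (-1) 1).Separates (leftPoles 1 ![((0 : ℂ), (1 : ℝ)), (-δ, γ)])
      (rightPoles 1 ![((0 : ℂ), (1 : ℝ))]) := by
  refine ⟨by norm_num, fun s hs => ?_, fun s hs => ?_⟩
  · obtain ⟨k, rfl⟩ := exists_eq_neg_of_mem_leftPoles hs
    have : (0 : ℝ) ≤ k := k.cast_nonneg
    simp only [neg_re, natCast_re, neg_im, natCast_im]
    refine ⟨by linarith, by norm_num, by norm_num⟩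
  · obtain ⟨k, rfl⟩ := exists_eq_add_one_of_mem_rightPoles hs
    have : (0 : ℝ) ≤ k := k.cast_nonneg
    simp only [add_re, natCast_re, one_re]
    rintro ⟨h, -⟩
    linarith

/-- Separating just the poles `0` and `1` forces `0 < c < 1` on lines and left loops, and `φ₁ < 0 <
φ₂` on both kinds of loop. -/
theorem integral_mlIntegrand {δ z : ℂ} {γ : ℝ} (hγ : 0 < γ) (hz : z ≠ 0) {L : Contour}
    (hL : L.Separates (leftPoles 1 ![((0 : ℂ), (1 : ℝ)), (-δ, γ)])
      (rightPoles 1 ![((0 : ℂ), (1 : ℝ))])) (hconv : L.Converges (mlIntegrand δ γ z)) :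
    L.integral (mlIntegrand δ γ z) =
      2 * Real.pi * I * ∑' k : ℕ, (-1) ^ k * entireFactor δ γ z (-k) := by
  have hP := zero_mem_leftPoles δ γ
  have hQ := one_mem_rightPoles
  cases L with
  | vertical c =>
    exact integral_vertical_mlIntegrand hγ hz
      ⟨by simpa using hL.1 0 hP, by simpa using hL.2 1 hQ⟩ hconv
  | leftLoop c φ₁ φ₂ =>
    obtain ⟨-, h1, h2⟩ := hL
    obtain ⟨h3, h4, h5⟩ := h1 0 hP
    rw [zero_re] at h3
    rw [zero_im] at h4 h5
    refine integral_leftLoop_mlIntegrand hγ hz h4 h5 ⟨h3, ?_⟩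
    by_contra hc
    exact h2 1 hQ ⟨by simpa using hc, by simpa using h4.le, by simpa using h5.le⟩
  | rightLoop c φ₁ φ₂ =>
    obtain ⟨h12, -, h2⟩ := hL
    obtain ⟨-, h4, h5⟩ := h2 1 hQ
    rw [one_im] at h4 h5
    -- At most one of the two rays has the exceptional height `δ.im / γ`; the other diverges.
    by_cases h : γ * φ₁ = δ.im
    · refine absurd hconv.2 (not_integrableOn_mlIntegrand_Ici hγ hz c h5.ne' ?_)
      rw [← h]
      exact (mul_lt_mul_of_pos_left h12 hγ).ne'
    · exact absurd hconv.1 (not_integrableOn_mlIntegrand_Ici hγ hz c h4.ne h)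

theorem hasValue_tsum {δ z : ℂ} {γ : ℝ} (hγ : 0 < γ) (hz : z ≠ 0) :
    HasValue 1 1 ![((0 : ℂ), (1 : ℝ))] ![((0 : ℂ), (1 : ℝ)), (-δ, γ)] z
      (∑' k : ℕ, (-1) ^ k * entireFactor δ γ z (-k)) := by
  rw [HasValue, integrand_eq_mlIntegrand]
  refine ⟨hz, ⟨_, separates_leftLoop δ γ, ?_⟩, fun L hL hconv => ?_⟩
  · exact ⟨integrableOn_mlIntegrand_Iic hγ hz _ (by norm_num),
      integrableOn_mlIntegrand_Iic hγ hz _ one_ne_zero⟩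
  · rw [integral_mlIntegrand hγ hz hL hconv, ← mul_assoc, one_div,
      inv_mul_cancel₀ two_pi_I_ne_zero, one_mul]

/-- At `s = -k` the power is an ordinary natural power, so no branch enters and the signs `(-1) ^ k`
cancel. -/
theorem neg_one_pow_mul_entireFactor (δ ζ : ℂ) (γ : ℝ) (k : ℕ) :
    (-1) ^ k * entireFactor δ γ (-ζ) (-k) = ζ ^ k / Gamma (γ * k + δ + 1) := by
  rw [entireFactor, neg_neg, cpow_natCast, div_eq_mul_inv, mul_left_comm, ← mul_pow, neg_one_mul,
    neg_neg, mul_comm]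
  congr 3
  ring

end FoxH

theorem corollary4p3 (x : ℝ) (α β δ : ℂ) (γ : ℝ) (hγ : 0 < γ)
    (hz : β * (x : ℂ) ^ α ≠ 0) :
    Summable (fun n : ℕ => (x : ℂ) ^ (α * (n : ℂ)) * β ^ n /
      Complex.Gamma ((γ : ℂ) * (n : ℂ) + δ + 1)) ∧
    FoxH.HasValue 1 1 ![((0 : ℂ), (1 : ℝ))] ![((0 : ℂ), (1 : ℝ)), (-δ, γ)]
      (-(β * (x : ℂ) ^ α))
      (∑' n : ℕ, (x : ℂ) ^ (α * (n : ℂ)) * β ^ n /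
        Complex.Gamma ((γ : ℂ) * (n : ℂ) + δ + 1)) := by
  have hterm : (fun n : ℕ => (x : ℂ) ^ (α * (n : ℂ)) * β ^ n /
      Complex.Gamma ((γ : ℂ) * (n : ℂ) + δ + 1)) =
      fun n : ℕ => (-1) ^ n * FoxH.entireFactor δ γ (-(β * (x : ℂ) ^ α)) (-n) := by
    ext n
    rw [FoxH.neg_one_pow_mul_entireFactor, Complex.cpow_mul_nat, mul_pow, mul_comm (β ^ n)]
  rw [hterm]
  exact ⟨FoxH.summable_residues hγ (neg_ne_zero.2 hz), FoxH.hasValue_tsum hγ (neg_ne_zero.2 hz)⟩
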